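/- Let $r>0$, let $\gamma_r=\{|z|=r\}$, and let $R=P/Q$ (in lowest terms) be a complex rational function of degree $n=\max(\deg P,\deg Q)$ with no poles on $\gamma_r$. Put $\mathcal R(z)=R(z)\,\overline{R(r^2/\overline z)}$. For $|z|<r$ let $d(z)$ be the multiplicity of $z$ as a pole of $\mathcal R$, where the poles of the two factors are counted without cancellation: $d(z)$ is the multiplicity of $z$ as a pole of $R(z)$ plus its multiplicity as a pole of $z\mapsto\overline{R(r^2/\overline z)}$ (a multiplicity is $0$ at a point that is not a pole). Let $z_1,\dots,z_\nu$ be the distinct points of the disc $|z|<r$ with $d(z_k)>0$, let $n_k=d(z_k)$, and set $$B(z)=\prod_{k=1}^{\nu}\Big(r\,\frac{z-z_k}{r^2-z\overline{z_k}}\Big)^{n_k},\qquad \mu(z)=\sum_{k=1}^{\nu}\frac{n_k(r^2-|z_k|^2)}{|z-z_k|^2}.$$ Then there are finitely many such points and $\sum_{k=1}^{\nu}n_k=n$. If the multiplicities of the poles of the function $\mathcal R$ itself in $|z|<r$ also add up to $n$, then $z_1,\dots,z_\nu$ are exactly the poles of $\mathcal R$ in $|z|<r$, and $n_1,\dots,n_\nu$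 are their multiplicities. Moreover, for all integers $m\ge 1$ and all $\varphi\in\mathbb R$ the equation $\zeta B^m(\zeta)=re^{i\varphi}$ has exactly $mn+1$ distinct roots $\zeta_k=\zeta_k(m,\varphi)$ in $\mathbb C$, all of them lie on $\gamma_r$, and (all integrands being integrable) $$\int_{\gamma_r}R(\zeta)\,|d\zeta|=2\pi r\sum_{k=1}^{n+1}\frac{R(\zeta_k)}{\mu(\zeta_k)+1},\qquad \zeta_k=\zeta_k(1,\varphi),$$ $$\|R\|_{L^{2m}(\gamma_r)}^{2m}:=\int_{\gamma_r}|R(\zeta)|^{2m}\,|d\zeta|=2\pi r\sum_{k=1}^{mn+1}\frac{|R(\zeta_k)|^{2m}}{m\,\mu(\zeta_k)+1},\qquad \zeta_k=\zeta_k(m,\varphi).$$ -/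

import Mathlib

namespace CircleQuadrature

/-- The degree of a rational function `P / Q` in lowest terms: `max (deg P) (deg Q)`. -/
noncomputable def ratDegree (R : RatFunc ℂ) : ℕ :=
  max R.num.natDegree R.denom.natDegree

/-- The function on `ℂ` given by a rational function, `P z / Q z` in lowest terms. -/
noncomputable def toFun (R : RatFunc ℂ) (z : ℂ) : ℂ :=
  R.eval (RingHom.id ℂ) z

/-- The function `z ↦ conj (R (r² / conj z))`. -/
noncomputable def reflected (r : ℝ) (R : RatFunc ℂ) (z : ℂ) : ℂ :=
  starRingEnd ℂ (toFun R ((r : ℂ) ^ 2 / starRingEnd ℂ z))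

/-- The function `𝓡 z = R z * conj (R (r² / conj z))`. -/
noncomputable def symmetrized (r : ℝ) (R : RatFunc ℂ) (z : ℂ) : ℂ :=
  toFun R z * reflected r R z

/-- The multiplicity of the point `z` as a pole of the meromorphic function `f`
(`0` if `z` is not a pole). Only the values of `f` in a punctured neighbourhood matter. -/
noncomputable def poleMult (f : ℂ → ℂ) (z : ℂ) : ℕ :=
  (-(meromorphicOrderAt f z).untop₀).toNat

/-- The multiplicity of `z` as a pole of the product `R z * conj (R (r² / conj z))`, where the
poles of the two factors are counted without cancellation. -/
noncomputable def symMult (r : ℝ) (R : RatFunc ℂ) (z : ℂ) : ℕ :=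
  poleMult (toFun R) z + poleMult (reflected r R) z

/-- The Blaschke product of the disc `|z| < r` whose zeros there are given by the
multiplicity function `d`. -/
noncomputable def blaschke (r : ℝ) (d : ℂ → ℕ) (z : ℂ) : ℂ :=
  ∏ᶠ w ∈ Metric.ball (0 : ℂ) r,
    ((r : ℂ) * ((z - w) / ((r : ℂ) ^ 2 - z * starRingEnd ℂ w))) ^ d w

/-- The weight `∑ d(w) (r² - |w|²) / |z - w|²` over the points `w` of the disc. -/
noncomputable def weight (r : ℝ) (d : ℂ → ℕ) (z : ℂ) : ℝ :=
  ∑ᶠ w ∈ Metric.ball (0 : ℂ) r, (d w : ℝ) * (r ^ 2 - ‖w‖ ^ 2) / ‖z - w‖ ^ 2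

/-- The solutions in `ℂ` of `ζ * B(ζ) ^ m = r * exp (i φ)`. -/
def notches (r : ℝ) (d : ℂ → ℕ) (m : ℕ) (φ : ℝ) : Set ℂ :=
  {ζ | ζ * blaschke r d ζ ^ m = (r : ℂ) * Complex.exp (Complex.I * (φ : ℂ))}

/-- The arc length integral of `f` over the circle `|ζ| = r`. -/
noncomputable def arcIntegral {E : Type*} [NormedAddCommGroup E] [NormedSpace ℝ E]
    (r : ℝ) (f : ℂ → E) : E :=
  ∫ θ in (0 : ℝ)..2 * Real.pi, r • f (circleMap 0 r θ)

end CircleQuadrature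

namespace CircleQuadrature

open Polynomial ComplexConjugate

/-! Let `Q` be the denominator of `R` and `Q*` its reflection in the circle, taken with formal
degree `n`. Roots of `Q * Q*` come in pairs symmetric about the circle, so `Q * Q*` is a constant
times `zeroPoly M * polePoly r M` for a multiset `M` of `n` points of the disc
(`exists_mul_reflectPoly`). Multiplicities in `M` are the values of `d`, and `B = r ^ n * zeroPoly M
/ polePoly r M`.

The equation `z * B z = a` with `|a| = r` is polynomial of degree `n + 1`. Its roots lie on the
circle because `|B| ≤ 1` inside and `|B| ≥ 1` outside, and are simple because `z * B' / B = μ ≥ 0`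
on the circle.

On the circle `R` and `|R|²` have the form `G = N / (zeroPoly M * polePoly r M)` with `deg N ≤ 2n`.
Splitting `G = U / zeroPoly M + V / polePoly r M`, the mean value property gives the average `V(0) /
polePoly(0)`. Lagrange interpolation at `0` in the roots of `nodePoly` gives the same value for the
weighted sum (`circleAverage_eq_sum_nodes`). Powers `B ^ m` and `|R| ^ (2m)` are covered by
replacing `M` with `m • M`. -/

/-- The monic polynomial with the multiset of roots `M`. -/
noncomputable def zeroPoly (M : Multiset ℂ) : ℂ[X] :=
  (M.map fun w => X - C w).prod

/-- The polynomial `∏ (r² - conj w * X)` over `w ∈ M`. -/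
noncomputable def polePoly (r : ℝ) (M : Multiset ℂ) : ℂ[X] :=
  (M.map fun w => C ((r : ℂ) ^ 2) - C (conj w) * X).prod

/-- The sum of the weights `(r² - |w|²) / |z - w|²` over `w ∈ M`. -/
noncomputable def multisetWeight (r : ℝ) (M : Multiset ℂ) (z : ℂ) : ℝ :=
  (M.map fun w => (r ^ 2 - ‖w‖ ^ 2) / ‖z - w‖ ^ 2).sum

/-- The polynomial `z ^ k * conj (p (r² / conj z))`, for `deg p ≤ k`. -/
noncomputable def reflectPoly (r : ℝ) (k : ℕ) (p : ℂ[X]) : ℂ[X] :=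
  C (conj p.leadingCoeff) * X ^ (k - p.natDegree) * polePoly r p.roots

/-! ### Numerator and denominator of a finite Blaschke product. -/

section Products

variable {r : ℝ} {M : Multiset ℂ} {z w : ℂ}

@[simp] lemma zeroPoly_zero : zeroPoly 0 = 1 := rfl

@[simp] lemma polePoly_zero : polePoly r 0 = 1 := rfl

@[simp] lemma zeroPoly_cons :
    zeroPoly (w ::ₘ M) = (X - C w) * zeroPoly M := by simp [zeroPoly]

@[simp] lemma polePoly_cons :
    polePoly r (w ::ₘ M) = (C ((r : ℂ) ^ 2) - C (conj w) * X) * polePoly r M := by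
  simp [polePoly]

lemma multisetWeight_cons :
    multisetWeight r (w ::ₘ M) z =
      (r ^ 2 - ‖w‖ ^ 2) / ‖z - w‖ ^ 2 + multisetWeight r M z := by
  simp [multisetWeight]

lemma zeroPoly_nsmul (m : ℕ) : zeroPoly (m • M) = zeroPoly M ^ m := by
  simp [zeroPoly, Multiset.map_nsmul, Multiset.prod_nsmul]

lemma polePoly_nsmul (m : ℕ) : polePoly r (m • M) = polePoly r M ^ m := by
  simp [polePoly, Multiset.map_nsmul, Multiset.prod_nsmul]

lemma multisetWeight_nsmul (m : ℕ) :
    multisetWeight r (m • M) z = m * multisetWeight r M z := by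
  simp [multisetWeight, Multiset.map_nsmul, Multiset.sum_nsmul]

lemma monic_zeroPoly : (zeroPoly M).Monic := by
  simpa [zeroPoly] using monic_multiset_prod_of_monic M (fun w => X - C w)
    fun w _ => monic_X_sub_C w

lemma natDegree_zeroPoly : (zeroPoly M).natDegree = M.card := by
  simp [zeroPoly, natDegree_multiset_prod_X_sub_C_eq_card]

lemma roots_zeroPoly : (zeroPoly M).roots = M := by
  simp [zeroPoly, roots_multiset_prod_X_sub_C]

lemma natDegree_polePoly_le : (polePoly r M).natDegree ≤ M.card := by
  induction M using Multiset.induction_on with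
  | empty => simp
  | cons w M ih =>
    rw [polePoly_cons, Multiset.card_cons]
    refine natDegree_mul_le.trans ?_
    have : (C ((r : ℂ) ^ 2) - C (conj w) * X).natDegree ≤ 1 := by compute_degree
    omega

lemma eval_zero_polePoly : (polePoly r M).eval 0 = ((r : ℂ) ^ 2) ^ M.card := by
  induction M using Multiset.induction_on with
  | empty => simp
  | cons w M ih => simp [ih, pow_succ']

/-- Factor by factor comparison of the two products. -/
lemma norm_factor_sq (r : ℝ) (z w : ℂ) :
    ‖(r : ℂ) ^ 2 - conj w * z‖ ^ 2 - (r * ‖z - w‖) ^ 2 =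
      (r ^ 2 - ‖z‖ ^ 2) * (r ^ 2 - ‖w‖ ^ 2) := by
  rw [mul_pow, ← Complex.normSq_eq_norm_sq, ← Complex.normSq_eq_norm_sq,
    ← Complex.normSq_eq_norm_sq, ← Complex.normSq_eq_norm_sq]
  simp only [Complex.normSq_apply, Complex.sub_re, Complex.sub_im, Complex.mul_re, Complex.mul_im,
    Complex.conj_re, Complex.conj_im, pow_two, Complex.ofReal_re, Complex.ofReal_im]
  ring

lemma factor_ne_zero (hr : 0 < r) (hw : ‖w‖ < r) (hz : ‖z‖ ≤ r) :
    (r : ℂ) ^ 2 - conj w * z ≠ 0 := by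
  intro h
  have h1 : ‖(r : ℂ) ^ 2‖ = ‖conj w * z‖ := by rw [sub_eq_zero.mp h]
  rw [norm_pow, Complex.norm_real, Real.norm_of_nonneg hr.le, norm_mul, RCLike.norm_conj] at h1
  nlinarith [norm_nonneg w, norm_nonneg z]

lemma eval_polePoly_ne_zero (hr : 0 < r) (hM : ∀ w ∈ M, ‖w‖ < r) (hz : ‖z‖ ≤ r) :
    (polePoly r M).eval z ≠ 0 := by
  induction M using Multiset.induction_on with
  | empty => simp
  | cons w M ih =>
    simp only [Multiset.mem_cons, forall_eq_or_imp] at hM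
    simpa using ⟨factor_ne_zero hr hM.1 hz, ih hM.2⟩

lemma eval_zeroPoly_ne_zero (hM : ∀ w ∈ M, ‖w‖ < r) (hz : r ≤ ‖z‖) :
    (zeroPoly M).eval z ≠ 0 := by
  induction M using Multiset.induction_on with
  | empty => simp
  | cons w M ih =>
    simp only [Multiset.mem_cons, forall_eq_or_imp] at hM
    have : z - w ≠ 0 := fun h => by
      rw [sub_eq_zero.mp h] at hz
      exact absurd hM.1 (not_lt.mpr hz)
    simpa using ⟨this, ih hM.2⟩

/-- This is `|B| ≤ 1` on the closed disc, factor by factor from the sign in `norm_factor_sq`;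
`le_norm_zeroPoly` is the opposite bound outside. -/
lemma norm_zeroPoly_le (hr : 0 < r) (hM : ∀ w ∈ M, ‖w‖ < r) (hz : ‖z‖ ≤ r) :
    r ^ M.card * ‖(zeroPoly M).eval z‖ ≤ ‖(polePoly r M).eval z‖ := by
  induction M using Multiset.induction_on with
  | empty => simp
  | cons w M ih =>
    simp only [Multiset.mem_cons, forall_eq_or_imp] at hM
    have h1 : r * ‖z - w‖ ≤ ‖(r : ℂ) ^ 2 - conj w * z‖ := by
      refine le_of_sq_le_sq ?_ (norm_nonneg _)
      have h2 := norm_factor_sq r z w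
      have h3 : 0 ≤ (r ^ 2 - ‖z‖ ^ 2) * (r ^ 2 - ‖w‖ ^ 2) :=
        mul_nonneg (by nlinarith [norm_nonneg z]) (by nlinarith [norm_nonneg w])
      linarith
    have := mul_le_mul h1 (ih hM.2) (by positivity) (norm_nonneg _)
    simp only [zeroPoly_cons, polePoly_cons, eval_mul, eval_sub, eval_X, eval_C, norm_mul,
      Multiset.card_cons]
    linarith [this, pow_succ' r M.card,
      show r ^ (M.card + 1) * (‖z - w‖ * ‖(zeroPoly M).eval z‖) =
        r * ‖z - w‖ * (r ^ M.card * ‖(zeroPoly M).eval z‖) by ring]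

lemma le_norm_zeroPoly (hr : 0 < r) (hM : ∀ w ∈ M, ‖w‖ < r) (hz : r ≤ ‖z‖) :
    ‖(polePoly r M).eval z‖ ≤ r ^ M.card * ‖(zeroPoly M).eval z‖ := by
  induction M using Multiset.induction_on with
  | empty => simp
  | cons w M ih =>
    simp only [Multiset.mem_cons, forall_eq_or_imp] at hM
    have h1 : ‖(r : ℂ) ^ 2 - conj w * z‖ ≤ r * ‖z - w‖ := by
      refine le_of_sq_le_sq ?_ (by positivity)
      have h2 := norm_factor_sq r z w
      have h3 : 0 ≤ (‖z‖ ^ 2 - r ^ 2) * (r ^ 2 - ‖w‖ ^ 2) :=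
        mul_nonneg (by nlinarith [norm_nonneg z]) (by nlinarith [norm_nonneg w])
      linarith
    have := mul_le_mul h1 (ih hM.2) (norm_nonneg _) (by positivity)
    simp only [zeroPoly_cons, polePoly_cons, eval_mul, eval_sub, eval_X, eval_C, norm_mul,
      Multiset.card_cons]
    linarith [this,
      show r ^ (M.card + 1) * (‖z - w‖ * ‖(zeroPoly M).eval z‖) =
        r * ‖z - w‖ * (r ^ M.card * ‖(zeroPoly M).eval z‖) by ring]

lemma conj_mul_of_norm_eq (hz : ‖z‖ = r) : conj z * z = (r : ℂ) ^ 2 := by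
  rw [mul_comm, Complex.mul_conj, Complex.normSq_eq_norm_sq, hz]
  push_cast
  rfl

lemma polePoly_eval_of_norm_eq (hz : ‖z‖ = r) :
    (polePoly r M).eval z = z ^ M.card * conj ((zeroPoly M).eval z) := by
  induction M using Multiset.induction_on with
  | empty => simp
  | cons w M ih =>
    simp only [zeroPoly_cons, polePoly_cons, eval_mul, eval_sub, eval_X, eval_C, ih, map_mul,
      map_sub, Multiset.card_cons, ← conj_mul_of_norm_eq hz]
    ring

/-- The logarithmic derivative of the Blaschke product on the circle. -/
lemma wronskian_eval (hM : ∀ w ∈ M, ‖w‖ < r) (hz : ‖z‖ = r) :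
    z * ((zeroPoly M).derivative.eval z * (polePoly r M).eval z -
      (zeroPoly M).eval z * (polePoly r M).derivative.eval z) =
    multisetWeight r M z * ((zeroPoly M).eval z * (polePoly r M).eval z) := by
  induction M using Multiset.induction_on with
  | empty => simp [multisetWeight]
  | cons w M ih =>
    simp only [Multiset.mem_cons, forall_eq_or_imp] at hM
    specialize ih hM.2
    have hzw : z - w ≠ 0 := fun h => by
      rw [sub_eq_zero.mp h] at hz
      exact absurd hM.1 (by simp [hz])
    have hcz : conj (z - w) ≠ 0 := (_root_.map_ne_zero _).mpr hzw
    have hfac : (r : ℂ) ^ 2 - conj w * z = z * conj (z - w) := by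
      rw [← conj_mul_of_norm_eq hz, map_sub]; ring
    have hw2 : ((‖w‖ : ℂ)) ^ 2 = w * conj w := by
      rw [Complex.mul_conj, Complex.normSq_eq_norm_sq]; push_cast; rfl
    have hzw2 : ((‖z - w‖ : ℂ)) ^ 2 = (z - w) * conj (z - w) := by
      rw [Complex.mul_conj, Complex.normSq_eq_norm_sq]; push_cast; rfl
    -- The identity for the single factor `w`; the product rule then adds the contributions of `w`
    -- and `M`.
    have key : (((r ^ 2 - ‖w‖ ^ 2) / ‖z - w‖ ^ 2 : ℝ) : ℂ) *
        ((z - w) * ((r : ℂ) ^ 2 - conj w * z)) = z * ((r : ℂ) ^ 2 - w * conj w) := by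
      push_cast
      rw [hw2, hzw2, hfac]
      field_simp
    simp only [zeroPoly_cons, polePoly_cons, eval_mul, eval_sub, eval_X, eval_C, derivative_mul,
      derivative_sub, derivative_X, derivative_C, eval_add, eval_one, eval_zero,
      multisetWeight_cons, Complex.ofReal_add]
    linear_combination (z - w) * ((r : ℂ) ^ 2 - conj w * z) * ih -
      (zeroPoly M).eval z * (polePoly r M).eval z * key

lemma multisetWeight_nonneg (hM : ∀ w ∈ M, ‖w‖ < r) : 0 ≤ multisetWeight r M z := by
  refine Multiset.sum_nonneg fun x hx => ?_
  obtain ⟨w, hw, rfl⟩ := Multiset.mem_map.mp hx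
  have := hM w hw
  exact div_nonneg (by nlinarith [norm_nonneg w]) (by positivity)

lemma isCoprime_zeroPoly_polePoly (hr : 0 < r) (hM : ∀ w ∈ M, ‖w‖ < r) :
    IsCoprime (zeroPoly M) (polePoly r M) := by
  -- Only the zeros are built up; `polePoly r M` stays fixed and vanishes at no point of `M`.
  refine Multiset.induction_on' (p := fun N => IsCoprime (zeroPoly N) (polePoly r M)) M ?_ ?_
  · simpa using isCoprime_one_left
  · intro w N hw _ ih
    rw [Multiset.insert_eq_cons, zeroPoly_cons]
    refine IsCoprime.mul_left ?_ ih
    rw [(irreducible_X_sub_C w).coprime_iff_not_dvd, dvd_iff_isRoot]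
    exact eval_polePoly_ne_zero hr hM (hM w hw).le

end Products

/-! ### Reflection of polynomials in the circle. -/

section Reflection

variable {r : ℝ} {p : ℂ[X]} {k : ℕ} {z : ℂ}

lemma polePoly_eval (M : Multiset ℂ) (hz : z ≠ 0) :
    (polePoly r M).eval z =
      z ^ M.card * conj ((zeroPoly M).eval ((r : ℂ) ^ 2 / conj z)) := by
  induction M using Multiset.induction_on with
  | empty => simp
  | cons w M ih =>
    simp only [zeroPoly_cons, polePoly_cons, eval_mul, eval_sub, eval_X, eval_C, ih]
    simp only [map_mul, map_sub, Multiset.card_cons, map_div₀, map_pow, Complex.conj_conj, Complex.conj_ofReal]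
    field_simp
    ring

lemma eq_C_mul_zeroPoly_roots (p : ℂ[X]) : p = C p.leadingCoeff * zeroPoly p.roots :=
  (IsAlgClosed.splits p).eq_prod_roots

lemma card_roots_eq (p : ℂ[X]) : p.roots.card = p.natDegree :=
  (IsAlgClosed.splits p).natDegree_eq_card_roots.symm

lemma reflectPoly_eval (hk : p.natDegree ≤ k) (hz : z ≠ 0) :
    (reflectPoly r k p).eval z = z ^ k * conj (p.eval ((r : ℂ) ^ 2 / conj z)) := by
  conv_rhs => rw [eq_C_mul_zeroPoly_roots p]
  rw [reflectPoly]
  simp only [eval_mul, eval_C, eval_pow, eval_X, polePoly_eval _ hz, map_mul, card_roots_eq]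
  rw [show z ^ k = z ^ (k - p.natDegree) * z ^ p.natDegree by rw [← pow_add]; congr 1; omega]
  ring

lemma natDegree_reflectPoly_le (hk : p.natDegree ≤ k) : (reflectPoly r k p).natDegree ≤ k := by
  have h1 := natDegree_polePoly_le (r := r) (M := p.roots)
  rw [card_roots_eq] at h1
  have h2 : (C (conj p.leadingCoeff) * X ^ (k - p.natDegree) : ℂ[X]).natDegree ≤
    k - p.natDegree := natDegree_C_mul_X_pow_le _ _
  exact natDegree_mul_le.trans (by omega)

lemma reflectPoly_ne_zero (hr : r ≠ 0) (hp : p ≠ 0) : reflectPoly r k p ≠ 0 := by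
  refine mul_ne_zero (mul_ne_zero (by simpa using hp) (by simp)) fun h => ?_
  have := eval_zero_polePoly (r := r) (M := p.roots)
  rw [h, eval_zero] at this
  exact pow_ne_zero _ (pow_ne_zero _ (Complex.ofReal_ne_zero.mpr hr)) this.symm

lemma eval_zero_reflectPoly (hk : p.natDegree < k) : (reflectPoly r k p).eval 0 = 0 := by
  simp [reflectPoly, show k - p.natDegree ≠ 0 by omega]

lemma eval_zero_reflectPoly_ne_zero (hr : r ≠ 0) (hp : p ≠ 0) (hk : p.natDegree = k) :
    (reflectPoly r k p).eval 0 ≠ 0 := by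
  simp [reflectPoly, hk, eval_zero_polePoly, hp, hr]

lemma reflectPoly_eval_of_norm_eq (hr : 0 < r) (hk : p.natDegree ≤ k) (hz : ‖z‖ = r) :
    (reflectPoly r k p).eval z = z ^ k * conj (p.eval z) := by
  have h0 : z ≠ 0 := norm_pos_iff.mp (hz ▸ hr)
  have h1 : conj z ≠ 0 := by simpa using h0
  rw [reflectPoly_eval hk h0, div_eq_iff h1 |>.mpr]
  rw [mul_comm, conj_mul_of_norm_eq hz]

/-- The product `(X - w) * (r² - conj w * X)` changes only by a constant when `w` is replaced by its
inverse point `r² / conj w`, so each root outside the disc can be moved inside. -/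
lemma exists_zeroPoly_mul_polePoly (hr : 0 < r) (S : Multiset ℂ) (hS : ∀ w ∈ S, ‖w‖ ≠ r) :
    ∃ M : Multiset ℂ, ∃ κ : ℂ, (∀ w ∈ M, ‖w‖ < r) ∧ M.card = S.card ∧ κ ≠ 0 ∧
      zeroPoly S * polePoly r S = C κ * (zeroPoly M * polePoly r M) := by
  induction S using Multiset.induction_on with
  | empty => exact ⟨0, 1, by simp, rfl, one_ne_zero, by simp⟩
  | cons w S ih =>
    simp only [Multiset.mem_cons, forall_eq_or_imp] at hS
    obtain ⟨M, κ, hM, hc, hκ, h⟩ := ih hS.2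
    have hr' : (r : ℂ) ≠ 0 := Complex.ofReal_ne_zero.mpr hr.ne'
    rcases lt_or_gt_of_ne hS.1 with hw | hw
    · refine ⟨w ::ₘ M, κ, ?_, by simp [hc], hκ, ?_⟩
      · simpa using ⟨hw, hM⟩
      · simp only [zeroPoly_cons, polePoly_cons]
        linear_combination (X - C w) * (C ((r : ℂ) ^ 2) - C (conj w) * X) * h
    · have hw0 : w ≠ 0 := norm_pos_iff.mp (hr.trans hw)
      have hcw : conj w ≠ 0 := by simpa using hw0
      set v : ℂ := (r : ℂ) ^ 2 / conj w with hv
      have hcv : conj v = (r : ℂ) ^ 2 / w := by simp [hv]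
      refine ⟨v ::ₘ M, κ * (w * conj w / (r : ℂ) ^ 2), ?_, by simp [hc], ?_, ?_⟩
      · simp only [Multiset.mem_cons, forall_eq_or_imp]
        refine ⟨?_, hM⟩
        rw [hv, norm_div, norm_pow, RCLike.norm_conj, Complex.norm_real,
          Real.norm_of_nonneg hr.le, div_lt_iff₀ (hr.trans hw)]
        nlinarith
      · exact mul_ne_zero hκ (div_ne_zero (mul_ne_zero hw0 hcw) (pow_ne_zero _ hr'))
      · have e : (X - C w) * (C ((r : ℂ) ^ 2) - C (conj w) * X) =
            C (w * conj w / (r : ℂ) ^ 2) * ((X - C v) * (C ((r : ℂ) ^ 2) - C (conj v) * X)) := by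
          apply Polynomial.funext
          intro x
          simp only [eval_mul, eval_sub, eval_X, eval_C, hcv]
          rw [hv]
          field_simp
          ring
        simp only [zeroPoly_cons, polePoly_cons, C_mul]
        linear_combination (X - C w) * (C ((r : ℂ) ^ 2) - C (conj w) * X) * h +
          C κ * zeroPoly M * polePoly r M * e

/-- A polynomial times its reflection is, up to a constant, the product of the numerator and the
denominator of a Blaschke product. -/
lemma exists_mul_reflectPoly (hr : 0 < r) (hp0 : p ≠ 0) (hk : p.natDegree ≤ k)
    (hp : ∀ z : ℂ, ‖z‖ = r → p.eval z ≠ 0) :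
    ∃ M : Multiset ℂ, ∃ κ : ℂ, (∀ w ∈ M, ‖w‖ < r) ∧ M.card = k ∧ κ ≠ 0 ∧
      p * reflectPoly r k p = C κ * (zeroPoly M * polePoly r M) := by
  obtain ⟨M, κ, hM, hc, hκ, h⟩ := exists_zeroPoly_mul_polePoly hr p.roots
    fun w hw hwr => hp w hwr (mem_roots hp0 |>.mp hw)
  have hr' : (r : ℂ) ^ 2 ≠ 0 := pow_ne_zero _ (Complex.ofReal_ne_zero.mpr hr.ne')
  -- The degree deficit of `p` becomes a zero of order `j` of the reflection at the origin. Hence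
  -- `0` is added `j` times; its pole factors are the constant `r²`, absorbed into the scalar.
  set j := k - p.natDegree with hj
  have hz : zeroPoly (M + j • {0}) = zeroPoly M * X ^ j := by
    simp [zeroPoly, Multiset.map_nsmul, Multiset.prod_nsmul]
  have hpole : polePoly r (M + j • {0}) = polePoly r M * C ((r : ℂ) ^ 2) ^ j := by
    simp [polePoly, Multiset.map_nsmul, Multiset.prod_nsmul]
  refine ⟨M + j • {0}, κ * p.leadingCoeff * conj p.leadingCoeff / ((r : ℂ) ^ 2) ^ j,
    ?_, ?_, ?_, ?_⟩
  · intro w hw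
    rcases Multiset.mem_add.mp hw with hw | hw
    · exact hM w hw
    · have := Multiset.mem_of_mem_nsmul hw
      simp only [Multiset.mem_singleton] at this
      simpa [this] using hr
  · rw [Multiset.card_add, hc, card_roots_eq]
    simp
    omega
  · have : p.leadingCoeff ≠ 0 := by simpa using hp0
    exact div_ne_zero (mul_ne_zero (mul_ne_zero hκ this) (by simpa using hp0))
      (pow_ne_zero _ hr')
  · rw [hz, hpole]
    have e : C (κ * p.leadingCoeff * conj p.leadingCoeff / ((r : ℂ) ^ 2) ^ j) *
        C ((r : ℂ) ^ 2) ^ j = C κ * C p.leadingCoeff * C (conj p.leadingCoeff) := by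
      rw [← C_pow, ← C_mul, ← C_mul, ← C_mul, div_mul_cancel₀ _ (pow_ne_zero _ hr')]
    rw [reflectPoly, ← hj]
    linear_combination C p.leadingCoeff * C (conj p.leadingCoeff) * X ^ j * h -
      zeroPoly M * polePoly r M * X ^ j * e +
      C (conj p.leadingCoeff) * X ^ j * polePoly r p.roots * eq_C_mul_zeroPoly_roots p

end Reflection

/-! ### Quadrature nodes: location, simplicity, interpolation. -/

/-- The polynomial whose roots solve `z * B z = a`, for the Blaschke product `B` with zeros `M`. -/
noncomputable def nodePoly (r : ℝ) (M : Multiset ℂ) (a : ℂ) : ℂ[X] :=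
  C ((r : ℂ) ^ M.card) * X * zeroPoly M - C a * polePoly r M

section Nodes

variable {r : ℝ} {M : Multiset ℂ} {a z : ℂ}

lemma eval_nodePoly : (nodePoly r M a).eval z =
    (r : ℂ) ^ M.card * z * (zeroPoly M).eval z - a * (polePoly r M).eval z := by
  simp [nodePoly]

lemma natDegree_nodePoly_leading (hr : 0 < r) :
    (nodePoly r M a).natDegree = M.card + 1 ∧ (nodePoly r M a).leadingCoeff = (r : ℂ) ^ M.card := by
  have hr' : (r : ℂ) ^ M.card ≠ 0 := pow_ne_zero _ (Complex.ofReal_ne_zero.mpr hr.ne')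
  have hmon : (X * zeroPoly M).Monic := monic_X.mul monic_zeroPoly
  have hdeg : (C ((r : ℂ) ^ M.card) * X * zeroPoly M).natDegree = M.card + 1 := by
    rw [mul_assoc, natDegree_C_mul hr', monic_X.natDegree_mul monic_zeroPoly, natDegree_X,
      natDegree_zeroPoly, add_comm]
  have hlt : (C a * polePoly r M).natDegree <
      (C ((r : ℂ) ^ M.card) * X * zeroPoly M).natDegree := by
    rw [hdeg]
    exact (natDegree_C_mul_le _ _).trans_lt (Nat.lt_succ_of_le natDegree_polePoly_le)
  constructor
  · rw [nodePoly, natDegree_sub_eq_left_of_natDegree_lt hlt, hdeg]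
  · rw [nodePoly, leadingCoeff_sub_of_degree_lt (degree_lt_degree hlt), mul_assoc,
      leadingCoeff_mul, leadingCoeff_C, hmon.leadingCoeff, mul_one]

/-- Inside the disc `|z * B z| < r` and outside `|z * B z| > r`, the strictness coming from the
factor `z`. -/
lemma norm_eq_of_isRoot_nodePoly (hr : 0 < r) (hM : ∀ w ∈ M, ‖w‖ < r) (ha : ‖a‖ = r)
    (hz : (nodePoly r M a).eval z = 0) : ‖z‖ = r := by
  rw [eval_nodePoly, sub_eq_zero] at hz
  have h := congrArg norm hz
  simp only [norm_mul, norm_pow, Complex.norm_real, Real.norm_of_nonneg hr.le, ha] at h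
  rcases lt_trichotomy ‖z‖ r with hlt | heq | hgt
  · have h1 := norm_zeroPoly_le hr hM hlt.le
    have h2 : 0 < ‖(polePoly r M).eval z‖ :=
      norm_pos_iff.mpr (eval_polePoly_ne_zero hr hM hlt.le)
    have h3 := mul_le_mul_of_nonneg_left h1 (norm_nonneg z)
    have h4 := mul_lt_mul_of_pos_right hlt h2
    linarith [show r ^ M.card * ‖z‖ * ‖(zeroPoly M).eval z‖ =
      ‖z‖ * (r ^ M.card * ‖(zeroPoly M).eval z‖) by ring]
  · exact heq
  · have h1 := le_norm_zeroPoly hr hM hgt.le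
    have h2 : 0 < r ^ M.card * ‖(zeroPoly M).eval z‖ :=
      mul_pos (pow_pos hr _) (norm_pos_iff.mpr (eval_zeroPoly_ne_zero hM hgt.le))
    have h3 := mul_le_mul_of_nonneg_left h1 hr.le
    have h4 := mul_lt_mul_of_pos_right hgt h2
    linarith [show r ^ M.card * ‖z‖ * ‖(zeroPoly M).eval z‖ =
      ‖z‖ * (r ^ M.card * ‖(zeroPoly M).eval z‖) by ring]

/-- After multiplication by `polePoly`, the root equation eliminates `a` and leaves the logarithmic
derivative of `z * B z`, namely `(μ + 1) / z`. -/
lemma eval_derivative_nodePoly (hr : 0 < r) (hM : ∀ w ∈ M, ‖w‖ < r) (hzr : ‖z‖ = r)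
    (hz : (nodePoly r M a).eval z = 0) :
    (nodePoly r M a).derivative.eval z =
      (r : ℂ) ^ M.card * (zeroPoly M).eval z * (multisetWeight r M z + 1) := by
  refine mul_right_cancel₀ (eval_polePoly_ne_zero hr hM hzr.le) ?_
  rw [eval_nodePoly] at hz
  have hw := wronskian_eval hM hzr
  simp only [nodePoly, derivative_sub, derivative_mul, derivative_C, derivative_X, eval_sub,
    eval_add, eval_mul, eval_C, eval_X, eval_zero, eval_one]
  linear_combination (r : ℂ) ^ M.card * hw + (polePoly r M).derivative.eval z * hz

lemma multisetWeight_add_one_ne_zero (hM : ∀ w ∈ M, ‖w‖ < r) :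
    (multisetWeight r M z : ℂ) + 1 ≠ 0 := by
  have := multisetWeight_nonneg (z := z) hM
  have h : multisetWeight r M z + 1 ≠ 0 := by positivity
  exact_mod_cast h

lemma eval_derivative_nodePoly_ne_zero (hr : 0 < r) (hM : ∀ w ∈ M, ‖w‖ < r) (hzr : ‖z‖ = r)
    (hz : (nodePoly r M a).eval z = 0) : (nodePoly r M a).derivative.eval z ≠ 0 := by
  rw [eval_derivative_nodePoly hr hM hzr hz]
  exact mul_ne_zero (mul_ne_zero (pow_ne_zero _ (Complex.ofReal_ne_zero.mpr hr.ne'))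
    (eval_zeroPoly_ne_zero hM hzr.ge)) (multisetWeight_add_one_ne_zero hM)

lemma nodePoly_ne_zero (hr : 0 < r) : nodePoly r M a ≠ 0 := fun h => by
  simpa [h] using (natDegree_nodePoly_leading (M := M) (a := a) hr).1

lemma nodup_roots_nodePoly (hr : 0 < r) (hM : ∀ w ∈ M, ‖w‖ < r) (ha : ‖a‖ = r) :
    (nodePoly r M a).roots.Nodup := by
  rw [Multiset.nodup_iff_count_le_one]
  intro z
  rw [count_roots]
  by_contra! h
  obtain ⟨h1, h2⟩ := (one_lt_rootMultiplicity_iff_isRoot (nodePoly_ne_zero hr)).mp h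
  exact eval_derivative_nodePoly_ne_zero hr hM (norm_eq_of_isRoot_nodePoly hr hM ha h1) h1 h2

lemma card_roots_toFinset_nodePoly (hr : 0 < r) (hM : ∀ w ∈ M, ‖w‖ < r) (ha : ‖a‖ = r) :
    (nodePoly r M a).roots.toFinset.card = M.card + 1 := by
  rw [Multiset.toFinset_card_of_nodup (nodup_roots_nodePoly hr hM ha), card_roots_eq,
    (natDegree_nodePoly_leading hr).1]

lemma nodePoly_eq_nodal (hr : 0 < r) (hM : ∀ w ∈ M, ‖w‖ < r) (ha : ‖a‖ = r) :
    nodePoly r M a =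
      C ((r : ℂ) ^ M.card) * Lagrange.nodal (nodePoly r M a).roots.toFinset id := by
  conv_lhs => rw [eq_C_mul_zeroPoly_roots (nodePoly r M a), (natDegree_nodePoly_leading hr).2]
  rw [Lagrange.nodal_eq, zeroPoly, Finset.prod, Multiset.toFinset_val,
    (nodup_roots_nodePoly hr hM ha).dedup]
  rfl

lemma mem_roots_toFinset_nodePoly (hr : 0 < r) :
    z ∈ (nodePoly r M a).roots.toFinset ↔ (nodePoly r M a).eval z = 0 := by
  rw [Multiset.mem_toFinset, mem_roots (nodePoly_ne_zero hr), IsRoot]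

/-- Lagrange interpolation at the origin in the roots of `nodePoly`. -/
lemma sum_eval_div_derivative_nodePoly (hr : 0 < r) (hM : ∀ w ∈ M, ‖w‖ < r) (ha : ‖a‖ = r)
    {W : ℂ[X]} (hW : W.natDegree ≤ M.card) :
    ∑ ζ ∈ (nodePoly r M a).roots.toFinset,
      W.eval ζ / (ζ * (nodePoly r M a).derivative.eval ζ) =
    W.eval 0 / (a * (polePoly r M).eval 0) := by
  set Z := (nodePoly r M a).roots.toFinset with hZ
  set c : ℂ := (r : ℂ) ^ M.card with hc
  have hc0 : c ≠ 0 := pow_ne_zero _ (Complex.ofReal_ne_zero.mpr hr.ne')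
  have hT : nodePoly r M a = C c * Lagrange.nodal Z id := nodePoly_eq_nodal hr hM ha
  have hne : ∀ ζ ∈ Z, (0 : ℂ) ≠ id ζ := fun ζ hζ h => by
    have h0 := norm_eq_of_isRoot_nodePoly hr hM ha ((mem_roots_toFinset_nodePoly hr).mp hζ)
    rw [← show (0 : ℂ) = ζ from h, norm_zero] at h0
    exact hr.ne h0
  have hdeg : W.degree < Z.card := by
    rw [hZ, card_roots_toFinset_nodePoly hr hM ha]
    exact degree_le_natDegree.trans_lt (by exact_mod_cast Nat.lt_succ_of_le hW)
  have h1 := congrArg (eval 0)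
    (Lagrange.eq_interpolate (v := id) (Function.injective_id.injOn) hdeg)
  rw [Lagrange.eval_interpolate_not_at_node _ hne] at h1
  -- At `0` only the term `-a * polePoly` of `nodePoly` survives.
  have h2 : c * (Lagrange.nodal Z id).eval 0 = -(a * (polePoly r M).eval 0) := by
    have := congrArg (eval 0) hT
    rw [eval_nodePoly] at this
    simp only [eval_mul, eval_C] at this
    rw [← this]; ring
  have hden : a * (polePoly r M).eval 0 ≠ 0 :=
    mul_ne_zero (norm_pos_iff.mp (ha ▸ hr)) (eval_polePoly_ne_zero hr hM (by simpa using hr.le))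
  -- The barycentric weight is the inverse derivative of the nodal polynomial, which is `nodePoly`
  -- divided by `c`.
  have hsum : ∑ ζ ∈ Z, Lagrange.nodalWeight Z id ζ * (0 - id ζ)⁻¹ * W.eval (id ζ) =
      -c * ∑ ζ ∈ Z, W.eval ζ / (ζ * (nodePoly r M a).derivative.eval ζ) := by
    rw [Finset.mul_sum]
    refine Finset.sum_congr rfl fun ζ hζ => ?_
    rw [Lagrange.nodalWeight_eq_eval_derivative_nodal hζ, hT]
    simp only [derivative_mul, derivative_C, zero_mul, zero_add, eval_mul, eval_C, id]
    have hζ0 : ζ ≠ 0 := (hne ζ hζ).symm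
    field_simp
    ring
  rw [hsum] at h1
  rw [eq_div_iff hden]
  linear_combination -h1 +
    (∑ ζ ∈ Z, W.eval ζ / (ζ * (nodePoly r M a).derivative.eval ζ)) * h2

end Nodes

/-! ### Circle averages and the general quadrature formula. -/

section Average

variable {r : ℝ} {M : Multiset ℂ} {a z : ℂ}

lemma circleIntegrable_div {p q : ℂ[X]} (hr : 0 < r) (hq : ∀ z : ℂ, ‖z‖ = r → q.eval z ≠ 0) :
    CircleIntegrable (fun z => p.eval z / q.eval z) 0 r := by
  refine ContinuousOn.circleIntegrable hr.le ?_
  exact p.continuous.continuousOn.div q.continuous.continuousOn fun z hz => hq z (by simpa using hz)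

lemma circleAverage_div_polePoly (hr : 0 < r) (hM : ∀ w ∈ M, ‖w‖ < r) (V : ℂ[X]) :
    Real.circleAverage (fun z => V.eval z / (polePoly r M).eval z) 0 r =
      V.eval 0 / (polePoly r M).eval 0 := by
  refine circleAverage_of_differentiable_on_off_countable (s := ∅) Set.countable_empty ?_ ?_
  · refine V.continuous.continuousOn.div (polePoly r M).continuous.continuousOn fun z hz => ?_
    exact eval_polePoly_ne_zero hr hM (by simpa [abs_of_pos hr] using hz)
  · intro z hz
    refine V.differentiableAt.div (polePoly r M).differentiableAt ?_
    have : ‖z‖ < r := by simpa [abs_of_pos hr] using hz.1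
    exact eval_polePoly_ne_zero hr hM this.le

/-- On the circle the integrand is the conjugate of `V / polePoly`, holomorphic in the disc; the
strict degree bound makes `V` vanish at `0`. -/
lemma circleAverage_div_zeroPoly (hr : 0 < r) (hM : ∀ w ∈ M, ‖w‖ < r) {U : ℂ[X]}
    (hU : U = 0 ∨ U.natDegree < M.card) :
    Real.circleAverage (fun z => U.eval z / (zeroPoly M).eval z) 0 r = 0 := by
  rcases hU with rfl | hU
  · simp [Real.circleAverage_def]
  set V := reflectPoly r M.card U with hV
  have h1 : Real.circleAverage (fun z => U.eval z / (zeroPoly M).eval z) 0 r =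
      Real.circleAverage ((Complex.conjCLE : ℂ →L[ℝ] ℂ) ∘
        fun z => V.eval z / (polePoly r M).eval z) 0 r := by
    refine Real.circleAverage_congr_sphere fun z hz => ?_
    have hz' : ‖z‖ = r := by simpa [abs_of_pos hr] using hz
    have hz0 : z ≠ 0 := norm_pos_iff.mp (hz' ▸ hr)
    simp only [Function.comp_apply, ContinuousLinearEquiv.coe_coe, Complex.conjCLE_apply]
    rw [hV, reflectPoly_eval_of_norm_eq hr hU.le hz', polePoly_eval_of_norm_eq hz',
      mul_div_mul_left _ _ (pow_ne_zero _ hz0), map_div₀, Complex.conj_conj, Complex.conj_conj]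
  rw [h1, ContinuousLinearMap.circleAverage_comp_comm, circleAverage_div_polePoly hr hM, hV,
    eval_zero_reflectPoly hU]
  · simp
  · exact circleIntegrable_div hr fun z hz => eval_polePoly_ne_zero hr hM hz.le

/-- Bézout, with the first numerator reduced modulo the monic `zeroPoly M`; the degree of `V` then
follows from `V * zeroPoly M = N - U * polePoly r M`. -/
lemma exists_partialFraction (hr : 0 < r) (hM : ∀ w ∈ M, ‖w‖ < r) {N : ℂ[X]}
    (hN : N.natDegree ≤ 2 * M.card) :
    ∃ U V : ℂ[X], N = U * polePoly r M + V * zeroPoly M ∧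
      (U = 0 ∨ U.natDegree < M.card) ∧ V.natDegree ≤ M.card := by
  obtain ⟨s, t, hst⟩ := isCoprime_zeroPoly_polePoly hr hM
  have hmon := monic_zeroPoly (M := M)
  set U := (N * t) %ₘ zeroPoly M with hU
  set V := N * s + (N * t) /ₘ zeroPoly M * polePoly r M with hV
  have hdiv := modByMonic_add_div (N * t) (zeroPoly M)
  have hUV : N = U * polePoly r M + V * zeroPoly M := by
    rw [hV, hU]
    linear_combination -N * hst - polePoly r M * hdiv
  have hUdeg : U = 0 ∨ U.natDegree < M.card := by
    by_cases h : U = 0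
    · exact Or.inl h
    · right
      have := degree_modByMonic_lt (N * t) hmon
      rw [← hU] at this
      rw [← natDegree_zeroPoly]
      exact natDegree_lt_natDegree h this
  refine ⟨U, V, hUV, hUdeg, ?_⟩
  have h1 : V * zeroPoly M = N - U * polePoly r M := by rw [hUV]; ring
  have h2 : (V * zeroPoly M).natDegree ≤ 2 * M.card := by
    rw [h1]
    refine (natDegree_sub_le _ _).trans (max_le hN ?_)
    refine natDegree_mul_le.trans ?_
    have := natDegree_polePoly_le (r := r) (M := M)
    rcases hUdeg with h | h
    · simp [h]; omega
    · omega
  by_cases hV0 : V = 0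
  · simp [hV0]
  · rw [mul_comm, hmon.natDegree_mul' hV0, natDegree_zeroPoly] at h2
    omega

/-- The quadrature formula on a circle for rational functions with prescribed poles. -/
theorem circleAverage_eq_sum_nodes (hr : 0 < r) (hM : ∀ w ∈ M, ‖w‖ < r) (ha : ‖a‖ = r)
    {N : ℂ[X]} (hN : N.natDegree ≤ 2 * M.card) {G : ℂ → ℂ}
    (hG : ∀ z : ℂ, ‖z‖ = r →
      G z = N.eval z / ((zeroPoly M).eval z * (polePoly r M).eval z)) :
    Real.circleAverage G 0 r =
      ∑ ζ ∈ (nodePoly r M a).roots.toFinset, G ζ / (multisetWeight r M ζ + 1) := by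
  obtain ⟨U, V, hUV, hU, hV⟩ := exists_partialFraction hr hM hN
  have hG' : ∀ z : ℂ, ‖z‖ = r →
      G z = U.eval z / (zeroPoly M).eval z + V.eval z / (polePoly r M).eval z := by
    intro z hz
    have h1 := eval_polePoly_ne_zero hr hM hz.le
    have h2 := eval_zeroPoly_ne_zero hM hz.ge
    rw [hG z hz, hUV, eval_add, eval_mul, eval_mul]
    field_simp
  have hleft : Real.circleAverage G 0 r = V.eval 0 / (polePoly r M).eval 0 := by
    rw [Real.circleAverage_congr_sphere
      (f₂ := fun z => U.eval z / (zeroPoly M).eval z + V.eval z / (polePoly r M).eval z)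
      fun z hz => hG' z (by simpa [abs_of_pos hr] using hz), Real.circleAverage_fun_add,
      circleAverage_div_zeroPoly hr hM hU, circleAverage_div_polePoly hr hM, zero_add]
    · exact circleIntegrable_div hr fun z hz => eval_zeroPoly_ne_zero hM hz.ge
    · exact circleIntegrable_div hr fun z hz => eval_polePoly_ne_zero hr hM hz.le
  -- At a node, `r ^ M.card * ζ * zeroPoly = a * polePoly`, so both fractions share a denominator:
  -- `G ζ = W ζ / (r ^ M.card * ζ * zeroPoly ζ)`. Hence `G ζ / (μ + 1)` is `W ζ / (ζ * nodePoly'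
  -- ζ)`, while `W 0 = a * V 0`.
  set W : ℂ[X] := C ((r : ℂ) ^ M.card) * (X * U) + C a * V with hW
  have hWdeg : W.natDegree ≤ M.card := by
    refine (natDegree_add_le _ _).trans (max_le ?_ ((natDegree_C_mul_le _ _).trans hV))
    refine (natDegree_C_mul_le _ _).trans ?_
    rcases hU with h | h
    · simp [h]
    · refine natDegree_mul_le.trans ?_
      rw [natDegree_X]
      omega
  have hsum := sum_eval_div_derivative_nodePoly hr hM ha hWdeg
  have ha0 : a ≠ 0 := norm_pos_iff.mp (ha ▸ hr)
  have hW0 : W.eval 0 = a * V.eval 0 := by simp [hW]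
  rw [hW0, mul_div_mul_left _ _ ha0] at hsum
  rw [hleft, ← hsum]
  refine Finset.sum_congr rfl fun ζ hζ => ?_
  have hroot := (mem_roots_toFinset_nodePoly hr).mp hζ
  have hζr := norm_eq_of_isRoot_nodePoly hr hM ha hroot
  have hζ0 : ζ ≠ 0 := norm_pos_iff.mp (hζr ▸ hr)
  have h1 := eval_polePoly_ne_zero hr hM hζr.le
  have h2 := eval_zeroPoly_ne_zero hM hζr.ge
  have h3 := multisetWeight_add_one_ne_zero (z := ζ) hM
  have hr0 : (r : ℂ) ≠ 0 := Complex.ofReal_ne_zero.mpr hr.ne'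
  rw [hG' ζ hζr, eval_derivative_nodePoly hr hM hζr hroot, hW]
  rw [eval_nodePoly] at hroot
  simp only [eval_add, eval_mul, eval_C, eval_X]
  field_simp
  linear_combination -V.eval ζ * hroot

end Average

open Filter Topology

/-! ### Pole multiplicities of quotients and products. -/

section PoleMultiplicity

variable {f g : ℂ → ℂ} {p q : ℂ[X]} {z : ℂ}

lemma meromorphicAt_of_eventuallyEq_div
    (hf : f =ᶠ[𝓝[≠] z] fun x => p.eval x / q.eval x) : MeromorphicAt f z := by
  have hp : AnalyticAt ℂ (fun x => p.eval x) z := AnalyticOnNhd.eval_polynomial p z trivial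
  have hq : AnalyticAt ℂ (fun x => q.eval x) z := AnalyticOnNhd.eval_polynomial q z trivial
  exact (hp.meromorphicAt.fun_div hq.meromorphicAt).congr hf.symm

lemma poleMult_of_eventuallyEq_div (hq : q ≠ 0) (hpq : p.eval z = 0 → q.eval z ≠ 0)
    (hf : f =ᶠ[𝓝[≠] z] fun x => p.eval x / q.eval x) :
    poleMult f z = q.rootMultiplicity z := by
  obtain ⟨u, hu, hdvd⟩ := exists_eq_pow_rootMultiplicity_mul_and_not_dvd q hq z
  set k := q.rootMultiplicity z with hk
  have huz : u.eval z ≠ 0 := fun h => hdvd (dvd_iff_isRoot.mpr h)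
  have hp : AnalyticAt ℂ (fun x => p.eval x) z := AnalyticOnNhd.eval_polynomial p z trivial
  have hua : AnalyticAt ℂ (fun x => u.eval x) z := AnalyticOnNhd.eval_polynomial u z trivial
  have hdiv : AnalyticAt ℂ (fun x => p.eval x / u.eval x) z := hp.fun_div hua huz
  -- A zero of `p` forces `k = 0`. The order may then be `⊤`, for which `untop₀` returns `0`, still
  -- the right multiplicity.
  by_cases hpz : p.eval z = 0
  · have hk0 : k = 0 := rootMultiplicity_eq_zero (hpq hpz)
    rw [hk0, pow_zero, one_mul] at hu
    have h := hdiv.meromorphicOrderAt_nonneg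
    rw [← hu, ← meromorphicOrderAt_congr hf] at h
    rw [hk0, poleMult]
    cases ho : meromorphicOrderAt f z with
    | top => simp
    | coe m =>
      rw [ho] at h
      have : 0 ≤ m := by exact_mod_cast h
      simpa using this
  · have : meromorphicOrderAt f z = ((-(k : ℤ) : ℤ) : WithTop ℤ) := by
      rw [meromorphicOrderAt_eq_int_iff (meromorphicAt_of_eventuallyEq_div hf)]
      refine ⟨_, hdiv, div_ne_zero hpz huz, ?_⟩
      filter_upwards [hf] with x hx
      rw [hx, hu]
      simp only [eval_mul, eval_pow, eval_sub, eval_X, eval_C, zpow_neg, zpow_natCast, smul_eq_mul]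
      rw [div_mul_eq_div_div_swap, div_eq_mul_inv, mul_comm]
    simp [poleMult, this]

lemma poleMult_mul_le (hf : MeromorphicAt f z) (hg : MeromorphicAt g z) :
    poleMult (fun x => f x * g x) z ≤ poleMult f z + poleMult g z := by
  have h := meromorphicOrderAt_mul hf hg
  rw [poleMult, poleMult, poleMult, show (fun x => f x * g x) = f * g from rfl, h]
  cases meromorphicOrderAt f z with
  | top => simp
  | coe a =>
    cases meromorphicOrderAt g z with
    | top => simp
    | coe b =>
      rw [← WithTop.coe_add]
      simp only [WithTop.untop₀_coe]
      omega

end PoleMultiplicity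

/-! ### Poles of a rational function and of its reflection. -/

section RationalFunction

variable {r : ℝ} {R : RatFunc ℂ} {z : ℂ}

lemma toFun_eq (R : RatFunc ℂ) (z : ℂ) : toFun R z = R.num.eval z / R.denom.eval z := by
  simp [toFun, RatFunc.eval]

lemma eval_denom_ne_zero_of_eval_num (h : R.num.eval z = 0) : R.denom.eval z ≠ 0 := by
  intro h'
  obtain ⟨s, t, hst⟩ := R.isCoprime_num_denom
  have := congrArg (eval z) hst
  simp [h, h'] at this

lemma natDegree_num_le : R.num.natDegree ≤ ratDegree R := le_max_left _ _

lemma natDegree_denom_le : R.denom.natDegree ≤ ratDegree R := le_max_right _ _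

lemma reflected_eq (hz : z ≠ 0) : reflected r R z =
    (reflectPoly r (ratDegree R) R.num).eval z / (reflectPoly r (ratDegree R) R.denom).eval z := by
  rw [reflectPoly_eval natDegree_num_le hz, reflectPoly_eval natDegree_denom_le hz,
    mul_div_mul_left _ _ (pow_ne_zero _ hz), reflected, toFun_eq, map_div₀]

lemma reflected_eventuallyEq (z : ℂ) : reflected r R =ᶠ[𝓝[≠] z] fun x =>
    (reflectPoly r (ratDegree R) R.num).eval x / (reflectPoly r (ratDegree R) R.denom).eval x := by
  have h : ∀ᶠ x in 𝓝[≠] z, x ≠ 0 := by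
    rcases eq_or_ne z 0 with rfl | hz
    · exact self_mem_nhdsWithin
    · exact (eventually_ne_nhds hz).filter_mono nhdsWithin_le_nhds
  filter_upwards [h] with x hx using reflected_eq hx

/-- Reflection keeps lowest terms. Away from `0` this is coprimality at the inverse point; at `0` it
holds because numerator or denominator attains the degree of `R`. -/
lemma eval_reflectPoly_denom_ne_zero (hr : r ≠ 0)
    (h : (reflectPoly r (ratDegree R) R.num).eval z = 0) :
    (reflectPoly r (ratDegree R) R.denom).eval z ≠ 0 := by
  rcases eq_or_ne z 0 with rfl | hz
  · by_cases hd : R.denom.natDegree = ratDegree R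
    · exact eval_zero_reflectPoly_ne_zero hr R.denom_ne_zero hd
    · have hn : R.num.natDegree = ratDegree R := by
        have := natDegree_denom_le (R := R)
        unfold ratDegree at *
        omega
      have hn0 : R.num ≠ 0 := by
        intro h0
        rw [h0, natDegree_zero] at hn
        have := natDegree_denom_le (R := R)
        omega
      exact absurd h (eval_zero_reflectPoly_ne_zero hr hn0 hn)
  · rw [reflectPoly_eval natDegree_num_le hz, mul_eq_zero, _root_.map_eq_zero] at h
    rw [reflectPoly_eval natDegree_denom_le hz]
    refine mul_ne_zero (pow_ne_zero _ hz) ((_root_.map_ne_zero _).mpr ?_)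
    exact eval_denom_ne_zero_of_eval_num (h.resolve_left (pow_ne_zero _ hz))

lemma symMult_eq_rootMultiplicity (hr : r ≠ 0) (z : ℂ) : symMult r R z =
    (R.denom * reflectPoly r (ratDegree R) R.denom).rootMultiplicity z := by
  have hq := R.denom_ne_zero
  have hq' : reflectPoly r (ratDegree R) R.denom ≠ 0 := reflectPoly_ne_zero hr hq
  rw [rootMultiplicity_mul (mul_ne_zero hq hq'), symMult,
    poleMult_of_eventuallyEq_div hq eval_denom_ne_zero_of_eval_num
      (Eventually.of_forall fun x => toFun_eq R x),
    poleMult_of_eventuallyEq_div hq' (eval_reflectPoly_denom_ne_zero hr)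
      (reflected_eventuallyEq z)]

lemma poleMult_symmetrized_le (r : ℝ) (R : RatFunc ℂ) (z : ℂ) :
    poleMult (symmetrized r R) z ≤ symMult r R z :=
  poleMult_mul_le
    (meromorphicAt_of_eventuallyEq_div (Eventually.of_forall fun x => toFun_eq R x))
    (meromorphicAt_of_eventuallyEq_div (reflected_eventuallyEq z))

end RationalFunction

/-! ### From the multiplicity function `d` to the multiset `M`. -/

section MultisetData

variable {r : ℝ} {d : ℂ → ℕ} {M : Multiset ℂ}

lemma inter_subset_toFinset {s : Set ℂ} {P : ℂ → Prop} (hd : ∀ w ∈ s, d w = M.count w)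
    (hP : ∀ w, P w → d w ≠ 0) : s ∩ {w | P w} ⊆ (M.toFinset : Set ℂ) := by
  rintro w ⟨hw, hPw⟩
  have := hP w hPw
  rw [hd w hw] at this
  simpa using this

lemma finprod_mem_pow_eq_multiset_prod {s : Set ℂ} (hd : ∀ w ∈ s, d w = M.count w)
    (hM : ∀ w ∈ M, w ∈ s) (f : ℂ → ℂ) :
    ∏ᶠ w ∈ s, f w ^ d w = (M.map f).prod := by
  have hMs : (M.toFinset : Set ℂ) ⊆ s := fun w hw => hM w (by simpa using hw)
  rw [finprod_mem_eq_prod_of_subset (t := M.toFinset) _ ?_ hMs, Finset.prod_multiset_map_count]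
  · exact Finset.prod_congr rfl fun w hw => by rw [hd w (hMs hw)]
  · exact inter_subset_toFinset hd fun w hw h => hw (by simp [h])

lemma finsum_mem_eq_multiset_card {s : Set ℂ} (hd : ∀ w ∈ s, d w = M.count w)
    (hM : ∀ w ∈ M, w ∈ s) : ∑ᶠ w ∈ s, d w = M.card := by
  have hMs : (M.toFinset : Set ℂ) ⊆ s := fun w hw => hM w (by simpa using hw)
  rw [finsum_mem_eq_sum_of_subset (t := M.toFinset) _ ?_ hMs, ← Multiset.toFinset_sum_count_eq]
  · exact Finset.sum_congr rfl fun w hw => hd w (hMs hw)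
  · exact inter_subset_toFinset hd fun w hw => hw

lemma weight_eq (hd : ∀ w ∈ Metric.ball (0 : ℂ) r, d w = M.count w)
    (hM : ∀ w ∈ M, ‖w‖ < r) (z : ℂ) : weight r d z = multisetWeight r M z := by
  have hMs : (M.toFinset : Set ℂ) ⊆ Metric.ball 0 r := fun w hw => by
    simpa using hM w (by simpa using hw)
  rw [weight, multisetWeight, finsum_mem_eq_sum_of_subset (t := M.toFinset) _ ?_ hMs,
    Finset.sum_multiset_map_count]
  · refine Finset.sum_congr rfl fun w hw => ?_
    rw [hd w (hMs hw), nsmul_eq_mul, mul_div_assoc]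
  · exact inter_subset_toFinset hd fun w hw h => hw (by simp [h])

lemma blaschke_eq (hd : ∀ w ∈ Metric.ball (0 : ℂ) r, d w = M.count w)
    (hM : ∀ w ∈ M, ‖w‖ < r) (z : ℂ) :
    blaschke r d z =
      (r : ℂ) ^ M.card * (zeroPoly M).eval z / (polePoly r M).eval z := by
  rw [blaschke, finprod_mem_pow_eq_multiset_prod hd fun w hw => by simpa using hM w hw]
  clear hd hM
  induction M using Multiset.induction_on with
  | empty => simp
  | cons w M ih =>
    simp only [Multiset.map_cons, Multiset.prod_cons, ih, zeroPoly_cons, polePoly_cons, eval_mul,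
      eval_sub, eval_X, eval_C, Multiset.card_cons]
    rw [mul_comm z, ← mul_div_assoc (r : ℂ), div_mul_div_comm]
    congr 1
    ring

lemma notches_eq_roots (hr : 0 < r) (hd : ∀ w ∈ Metric.ball (0 : ℂ) r, d w = M.count w)
    (hM : ∀ w ∈ M, ‖w‖ < r) {m : ℕ} (hm : m ≠ 0) (φ : ℝ) :
    ((nodePoly r (m • M) (r * Complex.exp (Complex.I * φ))).roots.toFinset : Set ℂ) =
      notches r d m φ := by
  set a : ℂ := r * Complex.exp (Complex.I * φ) with ha
  have har : ‖a‖ = r := by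
    rw [ha, norm_mul, mul_comm Complex.I, Complex.norm_exp_ofReal_mul_I, mul_one,
      Complex.norm_real, Real.norm_of_nonneg hr.le]
  have hmM : ∀ w ∈ m • M, ‖w‖ < r := fun w hw => hM w (Multiset.mem_of_mem_nsmul hw)
  ext z
  rw [Finset.mem_coe, mem_roots_toFinset_nodePoly hr, notches, Set.mem_ofPred_eq, ← ha,
    blaschke_eq hd hM]
  -- At a pole of `B`, division by zero gives `B` the value `0`. No spurious solution arises, since
  -- `m ≠ 0` and the right-hand side is nonzero.
  by_cases hz : (polePoly r M).eval z = 0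
  · constructor
    · intro h
      exact absurd hz (eval_polePoly_ne_zero hr hM (norm_eq_of_isRoot_nodePoly hr hmM har h).le)
    · intro h
      rw [hz, div_zero, zero_pow hm, mul_zero] at h
      rw [← h, norm_zero] at har
      exact absurd har hr.ne
  · rw [eval_nodePoly, zeroPoly_nsmul, polePoly_nsmul, eval_pow, eval_pow, Multiset.card_nsmul,
      sub_eq_zero, div_pow, mul_pow, ← mul_div_assoc, div_eq_iff (pow_ne_zero _ hz),
      mul_comm m, pow_mul]
    constructor <;> intro h <;> rw [← h] <;> ring

lemma arcIntegral_eq_circleAverage {E : Type*} [NormedAddCommGroup E] [NormedSpace ℝ E]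
    (r : ℝ) (f : ℂ → E) :
    arcIntegral r f = (2 * Real.pi * r) • Real.circleAverage f 0 r := by
  rw [arcIntegral, intervalIntegral.integral_smul, Real.circleAverage_def, smul_smul]
  congr 1
  field_simp

/-- `B ^ m` is the Blaschke product of `m • M`, with weight `m * μ`, so the quadrature formula is
applied to `m • M`. -/
lemma exists_nodes (hr : 0 < r) (hd : ∀ w ∈ Metric.ball (0 : ℂ) r, d w = M.count w)
    (hM : ∀ w ∈ M, ‖w‖ < r) {m : ℕ} (hm : m ≠ 0) (φ : ℝ) {N : ℂ[X]}
    (hN : N.natDegree ≤ 2 * (m * M.card)) {G : ℂ → ℂ}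
    (hG : ∀ z : ℂ, ‖z‖ = r →
      G z = N.eval z / ((zeroPoly M).eval z * (polePoly r M).eval z) ^ m) :
    ∃ Z : Finset ℂ, (Z : Set ℂ) = notches r d m φ ∧ Z.card = m * M.card + 1 ∧
      (∀ ζ ∈ Z, ‖ζ‖ = r) ∧
      arcIntegral r G =
        2 * (Real.pi : ℂ) * (r : ℂ) * ∑ ζ ∈ Z, G ζ / ((m : ℂ) * (weight r d ζ : ℂ) + 1) := by
  have hmM : ∀ w ∈ m • M, ‖w‖ < r := fun w hw => hM w (Multiset.mem_of_mem_nsmul hw)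
  have har : ‖(r : ℂ) * Complex.exp (Complex.I * φ)‖ = r := by
    rw [norm_mul, mul_comm Complex.I, Complex.norm_exp_ofReal_mul_I, mul_one,
      Complex.norm_real, Real.norm_of_nonneg hr.le]
  refine ⟨_, notches_eq_roots hr hd hM hm φ, ?_, fun ζ hζ => ?_, ?_⟩
  · rw [card_roots_toFinset_nodePoly hr hmM har, Multiset.card_nsmul]
  · exact norm_eq_of_isRoot_nodePoly hr hmM har ((mem_roots_toFinset_nodePoly hr).mp hζ)
  · rw [arcIntegral_eq_circleAverage, circleAverage_eq_sum_nodes hr hmM har (N := N)]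
    · simp only [multisetWeight_nsmul, weight_eq hd hM, Complex.real_smul]
      push_cast
      rfl
    · rwa [Multiset.card_nsmul]
    · intro z hz
      rw [hG z hz, zeroPoly_nsmul, polePoly_nsmul, eval_pow, eval_pow, mul_pow]

end MultisetData

/-! ### `R` and its squared modulus on the circle. -/

section Circle

variable {r : ℝ} {R : RatFunc ℂ} {M : Multiset ℂ} {κ z : ℂ}

lemma continuousOn_toFun (hpoles : ∀ z : ℂ, ‖z‖ = r → R.denom.eval z ≠ 0) :
    ContinuousOn (toFun R) (Metric.sphere 0 r) := by
  rw [show toFun R = fun z => R.num.eval z / R.denom.eval z from funext (toFun_eq R)]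
  exact R.num.continuous.continuousOn.div R.denom.continuous.continuousOn
    fun z hz => hpoles z (by simpa using hz)

lemma toFun_eq_div_on_circle (hr : 0 < r) (hz : ‖z‖ = r) (hzQ : R.denom.eval z ≠ 0) (hκ : κ ≠ 0)
    (h : R.denom * reflectPoly r (ratDegree R) R.denom = C κ * (zeroPoly M * polePoly r M)) :
    toFun R z = (C κ⁻¹ * (R.num * reflectPoly r (ratDegree R) R.denom)).eval z /
      ((zeroPoly M).eval z * (polePoly r M).eval z) := by
  have hz0 : z ≠ 0 := norm_pos_iff.mp (hz ▸ hr)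
  have h1 : (reflectPoly r (ratDegree R) R.denom).eval z ≠ 0 := by
    rw [reflectPoly_eval_of_norm_eq hr natDegree_denom_le hz]
    exact mul_ne_zero (pow_ne_zero _ hz0) ((_root_.map_ne_zero _).mpr hzQ)
  have h2 := congrArg (eval z) h
  simp only [eval_mul, eval_C] at h2
  have h3 : (zeroPoly M).eval z * (polePoly r M).eval z =
      κ⁻¹ * (R.denom.eval z * (reflectPoly r (ratDegree R) R.denom).eval z) := by
    rw [h2, inv_mul_cancel_left₀ hκ]
  rw [h3, toFun_eq]
  simp only [eval_mul, eval_C]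
  field_simp

/-- On the circle conjugation equals reflection up to `z ^ n`; these powers cancel between numerator
and denominator. -/
lemma norm_toFun_sq_eq_div_on_circle (hr : 0 < r) (hz : ‖z‖ = r) (hzQ : R.denom.eval z ≠ 0)
    (hκ : κ ≠ 0)
    (h : R.denom * reflectPoly r (ratDegree R) R.denom = C κ * (zeroPoly M * polePoly r M)) :
    ((‖toFun R z‖ : ℂ)) ^ 2 = (C κ⁻¹ * (R.num * reflectPoly r (ratDegree R) R.num)).eval z /
      ((zeroPoly M).eval z * (polePoly r M).eval z) := by
  have hz0 : z ≠ 0 := norm_pos_iff.mp (hz ▸ hr)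
  have hcQ : conj (R.denom.eval z) ≠ 0 := (_root_.map_ne_zero _).mpr hzQ
  have h2 := congrArg (eval z) h
  simp only [eval_mul, eval_C] at h2
  have h3 : (zeroPoly M).eval z * (polePoly r M).eval z =
      κ⁻¹ * (R.denom.eval z * (reflectPoly r (ratDegree R) R.denom).eval z) := by
    rw [h2, inv_mul_cancel_left₀ hκ]
  rw [h3, reflectPoly_eval_of_norm_eq hr natDegree_denom_le hz]
  simp only [eval_mul, eval_C]
  rw [reflectPoly_eval_of_norm_eq hr natDegree_num_le hz,
    show ((‖toFun R z‖ : ℂ)) ^ 2 = toFun R z * conj (toFun R z) by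
      rw [Complex.mul_conj, Complex.normSq_eq_norm_sq]; push_cast; rfl,
    toFun_eq, map_div₀]
  field_simp

end Circle

end CircleQuadrature

/-! ### Assembly of the theorem. -/

open CircleQuadrature Polynomial in
theorem mainTheorem1 (r : ℝ) (hr : 0 < r) (R : RatFunc ℂ) (n : ℕ)
    (hn : CircleQuadrature.ratDegree R = n)
    (hpoles : ∀ z : ℂ, ‖z‖ = r → R.denom.eval z ≠ 0)
    (d : ℂ → ℕ) (hd : d = CircleQuadrature.symMult r R) :
    -- the poles in the disc are finite in number and there are `n` of them with multiplicity
    {z : ℂ | z ∈ Metric.ball (0 : ℂ) r ∧ d z ≠ 0}.Finite ∧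
    (∑ᶠ z ∈ Metric.ball (0 : ℂ) r, d z) = n ∧
    -- the multiplicities are those of the poles of `𝓡` whenever these add up to `n`
    ((∑ᶠ z ∈ Metric.ball (0 : ℂ) r,
        CircleQuadrature.poleMult (CircleQuadrature.symmetrized r R) z) = n →
      ∀ z ∈ Metric.ball (0 : ℂ) r,
        d z = CircleQuadrature.poleMult (CircleQuadrature.symmetrized r R) z) ∧
    -- the quadrature formula for `R`
    (∀ φ : ℝ, ∃ Z : Finset ℂ,
      (Z : Set ℂ) = CircleQuadrature.notches r d 1 φ ∧ Z.card = n + 1 ∧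
      (∀ ζ ∈ Z, ‖ζ‖ = r) ∧
      CircleIntegrable (CircleQuadrature.toFun R) 0 r ∧
      CircleQuadrature.arcIntegral r (CircleQuadrature.toFun R) =
        2 * (Real.pi : ℂ) * (r : ℂ) *
          ∑ ζ ∈ Z, CircleQuadrature.toFun R ζ /
            ((CircleQuadrature.weight r d ζ : ℂ) + 1)) ∧
    -- the quadrature formula for the norm in `L^{2m}`
    (∀ (m : ℕ) (φ : ℝ), 1 ≤ m → ∃ Z : Finset ℂ,
      (Z : Set ℂ) = CircleQuadrature.notches r d m φ ∧ Z.card = m * n + 1 ∧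
      (∀ ζ ∈ Z, ‖ζ‖ = r) ∧
      CircleIntegrable (fun ζ => ‖CircleQuadrature.toFun R ζ‖ ^ (2 * m)) 0 r ∧
      CircleQuadrature.arcIntegral r (fun ζ => ‖CircleQuadrature.toFun R ζ‖ ^ (2 * m)) =
        2 * Real.pi * r *
          ∑ ζ ∈ Z, ‖CircleQuadrature.toFun R ζ‖ ^ (2 * m) /
            ((m : ℝ) * CircleQuadrature.weight r d ζ + 1)) := by
  obtain ⟨M, κ, hM, hcard, hκ, hfac⟩ := exists_mul_reflectPoly (k := ratDegree R) hr
    R.denom_ne_zero natDegree_denom_le hpoles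
  rw [hn] at hcard
  -- `polePoly r M` has no zeros in the disc, so only `zeroPoly M` contributes multiplicity there.
  have hcount : ∀ w ∈ Metric.ball (0 : ℂ) r, d w = M.count w := by
    intro w hw
    have hw' : ‖w‖ ≤ r := by simpa using (Metric.mem_ball.mp hw).le
    have hpole := eval_polePoly_ne_zero hr hM hw'
    have hne : zeroPoly M * polePoly r M ≠ 0 :=
      mul_ne_zero monic_zeroPoly.ne_zero fun h => hpole (by simp [h])
    rw [hd, symMult_eq_rootMultiplicity hr.ne', hfac,
      rootMultiplicity_mul (mul_ne_zero (C_ne_zero.mpr hκ) hne), rootMultiplicity_mul hne,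
      rootMultiplicity_eq_zero hpole, rootMultiplicity_C, ← count_roots, roots_zeroPoly, zero_add,
      add_zero]
  have hMball : ∀ w ∈ M, w ∈ Metric.ball (0 : ℂ) r := fun w hw => by simpa using hM w hw
  have hsub : {z : ℂ | z ∈ Metric.ball (0 : ℂ) r ∧ d z ≠ 0} ⊆ M.toFinset :=
    inter_subset_toFinset hcount fun w hw => hw
  have hsum : (∑ᶠ z ∈ Metric.ball (0 : ℂ) r, d z) = n :=
    (finsum_mem_eq_multiset_card hcount hMball).trans hcard
  have hcont := continuousOn_toFun hpoles
  refine ⟨M.toFinset.finite_toSet.subset hsub, hsum, ?_, ?_, ?_⟩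
  · intro hsym z hz
    have hle : ∀ w, poleMult (symmetrized r R) w ≤ d w := fun w =>
      hd ▸ poleMult_symmetrized_le r R w
    have hMs : (M.toFinset : Set ℂ) ⊆ Metric.ball 0 r := fun w hw => hMball w (by simpa using hw)
    have hzero : ∀ w ∈ Metric.ball (0 : ℂ) r, w ∉ M.toFinset → d w = 0 := fun w hw hw' => by
      by_contra h
      exact hw' (hsub ⟨hw, h⟩)
    -- Cancellation can only lower multiplicities, so equal totals over the finite set `M.toFinset`
    -- force equality term by term.
    rw [← hsum, finsum_mem_eq_sum_of_subset (t := M.toFinset) _ _ hMs,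
      finsum_mem_eq_sum_of_subset (t := M.toFinset) _ hsub hMs,
      Finset.sum_eq_sum_iff_of_le fun w _ => hle w] at hsym
    · by_cases hzM : z ∈ M.toFinset
      · exact (hsym z hzM).symm
      · have := hle z
        rw [hzero z hz hzM] at this ⊢
        omega
    · rintro w ⟨hw, hw'⟩
      exact hsub ⟨hw, fun h => hw' (Nat.le_zero.mp (h ▸ hle w))⟩
  · intro φ
    have hdeg : (C κ⁻¹ * (R.num * reflectPoly r (ratDegree R) R.denom)).natDegree ≤
        2 * (1 * M.card) := by
      have h1 := natDegree_num_le (R := R)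
      have h2 := natDegree_reflectPoly_le (r := r) (natDegree_denom_le (R := R))
      have h3 := natDegree_C_mul_le κ⁻¹ (R.num * reflectPoly r (ratDegree R) R.denom)
      have h4 := natDegree_mul_le (p := R.num) (q := reflectPoly r (ratDegree R) R.denom)
      omega
    obtain ⟨Z, hZ, hZc, hZr, hint⟩ := exists_nodes hr hcount hM one_ne_zero φ hdeg
      (G := toFun R) fun z hz => by
        rw [pow_one, toFun_eq_div_on_circle hr hz (hpoles z hz) hκ hfac]
    refine ⟨Z, hZ, by rw [hZc, hcard, one_mul], hZr, hcont.circleIntegrable hr.le, ?_⟩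
    simpa using hint
  · intro m φ hm
    have hdeg : ((C κ⁻¹ * (R.num * reflectPoly r (ratDegree R) R.num)) ^ m).natDegree ≤
        2 * (m * M.card) := by
      have h1 := natDegree_num_le (R := R)
      have h2 := natDegree_reflectPoly_le (r := r) (natDegree_num_le (R := R))
      have h3 := natDegree_C_mul_le κ⁻¹ (R.num * reflectPoly r (ratDegree R) R.num)
      have h4 := natDegree_mul_le (p := R.num) (q := reflectPoly r (ratDegree R) R.num)
      calc _ ≤ m * _ := natDegree_pow_le
        _ ≤ m * (2 * M.card) := Nat.mul_le_mul_left _ (by omega)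
        _ = 2 * (m * M.card) := by ring
    obtain ⟨Z, hZ, hZc, hZr, hint⟩ := exists_nodes hr hcount hM (Nat.one_le_iff_ne_zero.mp hm) φ
      hdeg (G := fun ζ => ((‖toFun R ζ‖ ^ (2 * m) : ℝ) : ℂ)) fun z hz => by
        rw [eval_pow, ← div_pow, ← norm_toFun_sq_eq_div_on_circle hr hz (hpoles z hz) hκ hfac]
        push_cast
        rw [pow_mul]
    refine ⟨Z, hZ, by rw [hZc, hcard], hZr, (hcont.norm.pow _).circleIntegrable hr.le, ?_⟩
    -- The quadrature formula is complex-valued; the real one follows by passing the cast through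
    -- the integral.
    have hcast : arcIntegral r (fun ζ => ((‖toFun R ζ‖ ^ (2 * m) : ℝ) : ℂ)) =
        ((arcIntegral r fun ζ => ‖toFun R ζ‖ ^ (2 * m) : ℝ) : ℂ) := by
      rw [arcIntegral, arcIntegral, ← intervalIntegral.integral_ofReal]
      simp
    rw [hcast] at hint
    exact_mod_cast hint
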